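/- **Conventions.** A signature is a set of operation symbols with finite arities, and an algebra $\mathbf A$ is a set $A$ with an operation $f^{\mathbf A}:A^{n}\to A$ for every $n$-ary symbol $f$. The algebra $\mathbf A$ is idempotent if $f^{\mathbf A}(a,\dots,a)=a$ for every basic operation $f^{\mathbf A}$ and every $a\in A$. An equation $s\approx t$ between terms holds in $\mathbf A$ if $s$ and $t$ have the same value for every evaluation of the variables in $A$. An equational condition is a set $\mathcal S$ of equations in some signature $\Delta$. An algebra $\mathbf A$ of signature $\Sigma$ satisfies $\mathcal S$ if the symbols of $\Delta$ can be replaced by terms of $\Sigma$ of the same arities so that all the equations in $\mathcal S$ hold in $\mathbf A$. The condition $\mathcal S$ is trivial if every algebra satisfies it. It is idempotent if, for each symbol $f\in\Delta$, the equation $f(x,\dots,x)\approx x$ holds in every algebra of signature $\Delta$ in which all equations of $\mathcal S$ hold. An algebra is Taylor if it satisfies some nontrivial idempotent equational condition. **Theorem.** For every idempotent algebra $\mathbf A$ the following are equivalent. (In (2)–(4) the arguments are grouped for readability only.) 1. $\mathbf A$ is a Taylor algebra. 2. $\mathbf A$ has a double loop term, i.e. a $12$-ary term $d$ satisfying $$d(xx,xxxx,yyyy,yy)\approx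 d(xx,yyyy,xxxx,yy),\qquad d(xy,xxyy,xxyy,xy)\approx d(yx,xyxy,xyxy,yx).$$ 3. $\mathbf A$ has a strong double loop term, i.e. a $12$-ary term $d$ satisfying $$d(xx,xxxx,yyyy,yy)\approx d(xx,yyyy,xxxx,yy)\approx d(xy,xxyy,xxyy,xy)\approx d(yx,xyxy,xyxy,yx).$$ 4. $\mathbf A$ has a weak $3$-cube term, i.e. a $6$-ary term $t$ satisfying $$t(xyy,yxx)\approx t(yxy,xyx)\approx t(yyx,xxy).$$ 5. $\mathbf A$ has $4$-ary terms $q_1,q_2$ and a ternary term $c$ satisfying $$q_1(x,y,x,y)\approx q_1(y,x,x,y)\approx q_2(x,y,x,y)\approx q_2(y,x,x,y),$$ $$q_1(x,x,y,y)\approx c(x,y,x),\qquad q_2(x,x,y,y)\approx c(y,x,x).$$ 6. $\mathbf A$ has terminator terms, i.e. ternary terms $c,c_1,c_2,c_{11},c_{12},c_{21},c_{22}$ satisfying, for $i\in\{1,2\}$, $$c(x,y,x)\approx c_1(x,x,y),\qquad c(y,x,x)\approx c_2(x,x,y),$$ $$c_i(x,y,x)\approx c_{i1}(x,x,y),\qquad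 c_i(y,x,x)\approx c_{i2}(x,x,y),$$ $$c_{i1}(x,y,x)\approx c_{i2}(x,y,x),\qquad c_{i1}(y,x,x)\approx c_{i2}(y,x,x).$$ 7. $\mathbf A$ has strong terminator terms, i.e. ternary terms satisfying the equations in (6) and moreover $c_{11}(y,x,x)\approx c_{22}(x,y,x)$. -/

import Mathlib

universe u v a w

namespace EqCond

/-- An algebra is a structure of a language without relation symbols. It is idempotent if every
basic operation `f` satisfies `f(x, …, x) = x`. -/
def IdempotentAlgebra (L : FirstOrder.Language.{u, v}) (A : Type a) [L.Structure A] : Prop :=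
  ∀ (n : ℕ) (f : L.Functions n) (x : A), FirstOrder.Language.Structure.funMap f (fun _ => x) = x

/-- An equation `s ≈ t`: a pair of terms, in variables indexed by `ℕ`. -/
abbrev Equation (L : FirstOrder.Language.{u, v}) := L.Term ℕ × L.Term ℕ

/-- `A ⊨ s ≈ t`: both terms have the same value under every evaluation of the variables in `A`. -/
def Holds {L : FirstOrder.Language.{u, v}} (A : Type a) [L.Structure A] (e : Equation L) : Prop :=
  ∀ z : ℕ → A, e.1.realize z = e.2.realize z

/-- The algebra `A` of signature `L` satisfies the equational condition `S` (a system of equations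
in a signature `D`): the symbols of `D` can be replaced by terms of `L` of the same arity so that
all equations of `S` become true in `A`. -/
def Satisfies {D : FirstOrder.Language.{w, 0}} (S : Set (Equation D)) (L : FirstOrder.Language.{u, v})
    (A : Type a) [L.Structure A] : Prop :=
  ∃ I : ∀ n : ℕ, D.Functions n → L.Term (Fin n), ∀ e ∈ S,
    Holds A ((e.1.substFunc fun {n} f => I n f, e.2.substFunc fun {n} f => I n f) : Equation L)

/-- `e` is a consequence of `S`: it holds in every algebra in which all equations of `S` hold. -/
def IsConsequence {D : FirstOrder.Language.{w, 0}} (S : Set (Equation D)) (e : Equation D) : Prop :=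
  ∀ (B : Type w) [D.Structure B], (∀ e' ∈ S, Holds B e') → Holds B e

/-- The equation `f(x, …, x) ≈ x`. -/
def idempotencyEquation {D : FirstOrder.Language.{w, 0}} {n : ℕ} (f : D.Functions n) : Equation D :=
  (FirstOrder.Language.Term.func f fun _ => FirstOrder.Language.Term.var 0, FirstOrder.Language.Term.var 0)

/-- An equational condition is idempotent if the idempotency of each of its operation symbols is
a consequence of its equations. -/
def IsIdempotentCondition {D : FirstOrder.Language.{w, 0}} (S : Set (Equation D)) : Prop :=
  ∀ (n : ℕ) (f : D.Functions n), IsConsequence S (idempotencyEquation f)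

/-- An equational condition is trivial if it is satisfied in every algebra. -/
def IsTrivialCondition {D : FirstOrder.Language.{w, 0}} (S : Set (Equation D)) : Prop :=
  ∀ (L : FirstOrder.Language.{w, 0}) [L.IsAlgebraic] (B : Type w) [L.Structure B], Satisfies S L B

/-- An algebra is Taylor if it satisfies a nontrivial idempotent equational condition (in an
arbitrary signature `D`, whose set of symbols lives in the universe `w`). -/
def IsTaylor (L : FirstOrder.Language.{u, v}) (A : Type a) [L.Structure A] : Prop :=
  ∃ (D : FirstOrder.Language.{w, 0}) (_ : D.IsAlgebraic) (S : Set (Equation D)),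
    IsIdempotentCondition S ∧ ¬ IsTrivialCondition S ∧ Satisfies S L A

section Terms

variable {L : FirstOrder.Language.{u, v}} (A : Type a) [L.Structure A]

/-- The double loop equations. -/
def IsDoubleLoopTerm (d : L.Term (Fin 12)) : Prop :=
  ∀ x y : A,
    d.realize ![x, x, x, x, x, x, y, y, y, y, y, y] =
      d.realize ![x, x, y, y, y, y, x, x, x, x, y, y] ∧
    d.realize ![x, y, x, x, y, y, x, x, y, y, x, y] =
      d.realize ![y, x, x, y, x, y, x, y, x, y, y, x]

/-- The strong double loop equations: the four sides of the double loop equations are equal. -/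
def IsStrongDoubleLoopTerm (d : L.Term (Fin 12)) : Prop :=
  ∀ x y : A,
    d.realize ![x, x, x, x, x, x, y, y, y, y, y, y] =
      d.realize ![x, x, y, y, y, y, x, x, x, x, y, y] ∧
    d.realize ![x, x, y, y, y, y, x, x, x, x, y, y] =
      d.realize ![x, y, x, x, y, y, x, x, y, y, x, y] ∧
    d.realize ![x, y, x, x, y, y, x, x, y, y, x, y] =
      d.realize ![y, x, x, y, x, y, x, y, x, y, y, x]

/-- The weak 3-cube equations. -/
def IsWeakThreeCubeTerm (t : L.Term (Fin 6)) : Prop :=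
  ∀ x y : A,
    t.realize ![x, y, y, y, x, x] = t.realize ![y, x, y, x, y, x] ∧
    t.realize ![y, x, y, x, y, x] = t.realize ![y, y, x, x, x, y]

/-- The equations for the 4-ary terms `q₁`, `q₂` and the ternary term `c`. -/
def IsQQCTerms (q₁ q₂ : L.Term (Fin 4)) (c : L.Term (Fin 3)) : Prop :=
  ∀ x y : A,
    q₁.realize ![x, y, x, y] = q₁.realize ![y, x, x, y] ∧
    q₁.realize ![y, x, x, y] = q₂.realize ![x, y, x, y] ∧
    q₂.realize ![x, y, x, y] = q₂.realize ![y, x, x, y] ∧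
    q₁.realize ![x, x, y, y] = c.realize ![x, y, x] ∧
    q₂.realize ![x, x, y, y] = c.realize ![y, x, x]

/-- The terminator equations for seven ternary terms `c`, `c_i`, `c_ij`, where `i, j ∈ {1, 2}`.
The index `1` is `0 : Fin 2` and the index `2` is `1 : Fin 2`. -/
def IsTerminator (c : L.Term (Fin 3)) (c₁ : Fin 2 → L.Term (Fin 3))
    (c₂ : Fin 2 → Fin 2 → L.Term (Fin 3)) : Prop :=
  ∀ x y : A,
    (c.realize ![x, y, x] = (c₁ 0).realize ![x, x, y] ∧
      c.realize ![y, x, x] = (c₁ 1).realize ![x, x, y]) ∧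
    (∀ i : Fin 2, (c₁ i).realize ![x, y, x] = (c₂ i 0).realize ![x, x, y] ∧
      (c₁ i).realize ![y, x, x] = (c₂ i 1).realize ![x, x, y]) ∧
    (∀ i : Fin 2, (c₂ i 0).realize ![x, y, x] = (c₂ i 1).realize ![x, y, x] ∧
      (c₂ i 0).realize ![y, x, x] = (c₂ i 1).realize ![y, x, x])

/-- The strong terminator equations: additionally `c₁₁(y, x, x) ≈ c₂₂(x, y, x)`. -/
def IsStrongTerminator (c : L.Term (Fin 3)) (c₁ : Fin 2 → L.Term (Fin 3))
    (c₂ : Fin 2 → Fin 2 → L.Term (Fin 3)) : Prop :=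
  IsTerminator A c c₁ c₂ ∧
    ∀ x y : A, (c₂ 0 0).realize ![y, x, x] = (c₂ 1 1).realize ![x, y, x]

end Terms

end EqCond

/-! The identities are read as relations. Binary term operations of `A` form an algebra generated by
the two projections. A double loop term is a tuple (f, f, h, h) in the 4-ary relation
`DoubleLoopRel`, generated by the projection tuples (α, β, γ, δ) with α ≠ β or γ ≠ δ; a weak 3-cube
term is a constant triple in `CubeRel`, generated by the nonconstant triples of projections.

From Taylor to double loop: suppose that there is no double loop and that `A` has at least two
elements. If every variable of a term T were separated by an identity between two renamings of T,
then the pairs (h, k) with (f, f, h, k) in the relation for some f would form a symmetric relation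
that absorbs through T. Such a relation has a loop (`exists_loop`), which is a double loop. So every
term has a variable respected by all these identities. Common terms and a compactness argument turn
this into a coherent choice of one variable per term (`exists_isCoherentChoice`). The choice
commutes with composition, so it interprets every condition satisfied by `A` in projections, and all
these conditions are trivial.

A double loop becomes strong by composition (`exists_strong_double_loop`). The weak 3-cube term
comes from a triple nesting of the strong term: in `exists_const_triple` the three entries of the
triple are expanded along three consecutive subwords of one word of five indices. The terms in (5)
and (7) are renamings of a strong double loop term. Conversely, no choice of one coordinate per term
is compatible with the weak cube or terminator equations, hence they are nontrivial
(`isTaylor_of_minors`). -/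

namespace EqCond

/-! ### Loops in symmetric absorbing relations -/

/-- `E` is a symmetric binary relation on the subuniverse `B` of the algebra `(W; t)`, and it
absorbs `B × B` by `t`: one of the pairs that `t` is applied to need not be in `E`. -/
structure SymmAbsorbing {W ι : Type*} (t : (ι → W) → W) (B : Set W) (E : W → W → Prop) : Prop where
  closed : ∀ c : ι → W, (∀ i, c i ∈ B) → t c ∈ B
  mem : ∀ a b, E a b → a ∈ B
  symm : ∀ a b, E a b → E b a
  absorb : ∀ (i : ι) (c d : ι → W), c i ∈ B → d i ∈ B → (∀ j, j ≠ i → E (c j) (d j)) → E (t c) (t d)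

/-- There is a walk of length `k` from `a` to `b` in the digraph `E`. -/
def Walk {W : Type*} (E : W → W → Prop) : ℕ → W → W → Prop
  | 0, a, b => a = b
  | k + 1, a, b => ∃ c, E a c ∧ Walk E k c b

section Walk

variable {W : Type*} {E E' : W → W → Prop}

theorem walk_one {a b : W} : Walk E 1 a b ↔ E a b := by simp [Walk]

theorem walk_add {m n : ℕ} {a b : W} :
    Walk E (m + n) a b ↔ ∃ c, Walk E m a c ∧ Walk E n c b := by
  induction m generalizing a with
  | zero => simp [Walk]
  | succ m ih =>
    rw [Nat.add_right_comm]
    simp only [Walk, ih]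
    constructor
    · rintro ⟨c, hc, e, he, h⟩; exact ⟨e, ⟨c, hc, he⟩, h⟩
    · rintro ⟨e, ⟨c, hc, he⟩, h⟩; exact ⟨c, hc, e, he, h⟩

theorem Walk.mono (h : ∀ a b, E a b → E' a b) {k : ℕ} {a b : W} (hw : Walk E k a b) :
    Walk E' k a b := by
  induction k generalizing a with
  | zero => exact hw
  | succ k ih => obtain ⟨c, hc, hw⟩ := hw; exact ⟨c, h _ _ hc, ih hw⟩

theorem Walk.symm (h : ∀ a b, E a b → E b a) {k : ℕ} {a b : W} (hw : Walk E k a b) :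
    Walk E k b a := by
  induction k generalizing a with
  | zero => exact Eq.symm hw
  | succ k ih =>
    obtain ⟨c, hc, hw⟩ := hw
    exact walk_add.2 ⟨c, ih hw, walk_one.2 (h _ _ hc)⟩

end Walk

namespace SymmAbsorbing

variable {W ι : Type*} {t : (ι → W) → W} {B : Set W} {E : W → W → Prop}

theorem walk_mem_right (h : SymmAbsorbing t B E) {k : ℕ} {a b : W}
    (hab : Walk E (k + 1) a b) : b ∈ B := by
  obtain ⟨c, hc, -⟩ := Walk.symm h.symm hab
  exact h.mem _ _ hc

/-- The free coordinate jumps to its final value in the first step and then stays there; the other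
coordinates follow their walks. -/
theorem walk_absorb (h : SymmAbsorbing t B E) (k : ℕ) (i : ι) (c d : ι → W) (hc : c i ∈ B)
    (hd : d i ∈ B) (hcd : ∀ j, j ≠ i → Walk E (k + 1) (c j) (d j)) :
    Walk E (k + 1) (t c) (t d) := by
  classical
  induction k generalizing c with
  | zero => exact walk_one.2 (h.absorb i c d hc hd fun j hj => walk_one.1 (hcd j hj))
  | succ k ih =>
    have : ∀ j, ∃ e, j ≠ i → E (c j) e ∧ Walk E (k + 1) e (d j) := fun j =>
      (em (j = i)).elim (fun hj => ⟨c j, fun h => absurd hj h⟩)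
        fun hj => (hcd j hj).imp fun _ h _ => h
    choose e he using this
    refine ⟨t (Function.update e i (d i)), h.absorb i _ _ hc (by simpa using hd) ?_, ih _ ?_ ?_⟩
    · intro j hj; simpa [hj] using (he j hj).1
    · simpa using hd
    · intro j hj; simpa [hj] using (he j hj).2

/-- The restriction to the endpoints of the walks of length `k + 1` from `x`. -/
theorem restrict [Nonempty ι] (h : SymmAbsorbing t B E) (ht : ∀ a, t (fun _ => a) = a) (k : ℕ)
    {x : W} (hx : x ∈ B) :
    SymmAbsorbing t {b | Walk E (k + 1) x b}
      fun a b => (Walk E (k + 1) x a ∧ Walk E (k + 1) x b) ∧ E a b where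
  closed c hc := by
    have i := Classical.arbitrary ι
    have := h.walk_absorb k i (fun _ => x) c hx (h.walk_mem_right (hc i)) fun j _ => hc j
    rwa [ht] at this
  mem a b hab := hab.1.1
  symm a b hab := ⟨hab.1.symm, h.symm _ _ hab.2⟩
  absorb i c d hc hd hcd := by
    have key : ∀ c : ι → W, Walk E (k + 1) x (c i) → (∀ j, j ≠ i → Walk E (k + 1) x (c j)) →
        Walk E (k + 1) x (t c) := by
      intro c hc hc'
      have := h.walk_absorb k i (fun _ => x) c hx (h.walk_mem_right hc) hc'
      rwa [ht] at this
    exact ⟨⟨key c hc fun j hj => (hcd j hj).1.1, key d hd fun j hj => (hcd j hj).1.2⟩,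
      h.absorb i c d (h.walk_mem_right hc) (h.walk_mem_right hd) fun j hj => (hcd j hj).2⟩

/-- Start with a constant tuple and walk along an edge in all coordinates, each step but leaving one
coordinate where it is. -/
theorem walk_flip [DecidableEq ι] (h : SymmAbsorbing t B E) (ht : ∀ a, t (fun _ => a) = a) (p : Bool → W)
    (hp : ∀ b, E (p b) (p !b)) (s : Finset ι) :
    Walk E s.card (p true) (t fun j => p (decide (j ∈ s) ^^ decide (Even s.card))) := by
  induction s using Finset.induction_on with
  | empty => simp [Walk, ht]
  | insert i s hi ih =>
    rw [Finset.card_insert_of_notMem hi]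
    refine walk_add.2 ⟨_, ih, walk_one.2 (h.absorb i _ _ (h.mem _ _ (hp _)) (h.mem _ _ (hp _)) ?_)⟩
    intro j hj
    have := hp (decide (j ∈ s) ^^ decide (Even s.card))
    convert this using 2
    simp only [Finset.mem_insert, hj, false_or, Nat.even_add_one]
    cases decide (j ∈ s) <;> by_cases h2 : Even s.card <;> simp [h2]

/-- With n coordinates, n steps of `walk_flip` move each coordinate n - 1 times. This ends at the
start if n is odd, and at the other end of the edge if n is even, when one more step closes the
walk. -/
theorem exists_odd_walk [Fintype ι] (h : SymmAbsorbing t B E) (ht : ∀ a, t (fun _ => a) = a)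
    {x y : W} (hxy : E x y) : ∃ z, Walk E (2 * (Fintype.card ι / 2) + 1) z z := by
  have hp : ∀ b, E (bif b then x else y) (bif !b then x else y) := by
    intro b; cases b
    · exact h.symm _ _ hxy
    · exact hxy
  classical
  have hw := h.walk_flip ht _ hp Finset.univ
  simp only [Finset.mem_univ, Finset.card_univ] at hw
  rcases Nat.even_or_odd' (Fintype.card ι) with ⟨m, hm | hm⟩
  · refine ⟨x, ?_⟩
    rw [hm, Nat.mul_div_cancel_left _ (by norm_num)]
    refine walk_add.2 ⟨y, ?_, walk_one.2 (h.symm _ _ hxy)⟩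
    have h3 : Even (Fintype.card ι) := by rw [hm]; simp
    simp only [h3, ht] at hw
    simpa [hm] using hw
  · refine ⟨x, ?_⟩
    have h2 : 2 * (Fintype.card ι / 2) + 1 = Fintype.card ι := by omega
    rw [h2]
    have h3 : ¬ Even (Fintype.card ι) := by rw [hm]; simp
    simpa [ht, h3] using hw

/-- If the walk relation of length `k + 1` always has a triangle-like configuration, then it
contains arbitrarily large cliques. -/
theorem exists_clique [Nonempty ι] (ht : ∀ a, t (fun _ => a) = a) (k : ℕ)
    (hk : ∀ (B : Set W) (E : W → W → Prop), SymmAbsorbing t B E → (∃ x y, E x y) →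
      ∃ x y z, x ∈ B ∧ Walk E (k + 1) x y ∧ Walk E (k + 1) x z ∧ E y z) (N : ℕ) :
    ∀ (B : Set W) (E : W → W → Prop), SymmAbsorbing t B E → (∃ x y, E x y) →
      ∃ v : Fin N → W, (∀ i, v i ∈ B) ∧ ∀ i j, i ≠ j → Walk E (k + 1) (v i) (v j) := by
  induction N with
  | zero => intro B E _ _; exact ⟨Fin.elim0, fun i => i.elim0, fun i => i.elim0⟩
  | succ N ih =>
    intro B E h hE
    obtain ⟨x, y, z, hx, hy, hz, hyz⟩ := hk B E h hE
    -- The rest of the clique is found among the endpoints of walks from `x`; the edge from `y` to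
    -- `z` makes the restricted relation nonempty.
    obtain ⟨v, hv, hvv⟩ := ih _ _ (h.restrict ht k hx) ⟨y, z, ⟨hy, hz⟩, hyz⟩
    refine ⟨Fin.cons x v, ?_, ?_⟩
    · intro i; cases i using Fin.cases
      · exact hx
      · exact h.walk_mem_right (hv _)
    · intro i j hij
      cases i using Fin.cases with
      | zero =>
        cases j using Fin.cases with
        | zero => exact absurd rfl hij
        | succ j => exact hv j
      | succ i =>
        cases j using Fin.cases with
        | zero => exact Walk.symm h.symm (hv i)
        | succ j =>
          exact (hvv i j fun hc => hij (by rw [hc])).mono fun a b hab => hab.2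

/-- Take a clique `v` with one vertex per coordinate of `t`. Comparing the constant tuple `v i` with
`v` leaves only coordinate `i` unmatched, so absorption joins every `v i` to `t v`; applying `t`
once more joins `t v` to itself. -/
theorem exists_walk_self [Fintype ι] [Nonempty ι] (ht : ∀ a, t (fun _ => a) = a) (k : ℕ)
    (hk : ∀ (B : Set W) (E : W → W → Prop), SymmAbsorbing t B E → (∃ x y, E x y) →
      ∃ x y z, x ∈ B ∧ Walk E (k + 1) x y ∧ Walk E (k + 1) x z ∧ E y z)
    (h : SymmAbsorbing t B E) (hE : ∃ x y, E x y) : ∃ z, Walk E (k + 1) z z := by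
  obtain ⟨v', hv', hvv'⟩ := exists_clique ht k hk (Fintype.card ι) B E h hE
  let v : ι → W := fun i => v' (Fintype.equivFin ι i)
  have hv : ∀ i, v i ∈ B := fun i => hv' _
  have hvv : ∀ i j, i ≠ j → Walk E (k + 1) (v i) (v j) := fun i j hij => hvv' _ _ (by simpa using hij)
  have h1 : ∀ i, Walk E (k + 1) (v i) (t v) := by
    intro i
    have := h.walk_absorb k i (fun _ => v i) v (hv i) (hv i) fun j hj => hvv i j hj.symm
    rwa [ht] at this
  have i := Classical.arbitrary ι
  have := h.walk_absorb k i v (fun _ => t v) (hv i) (h.closed _ hv) fun j _ => h1 j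
  rw [ht] at this
  exact ⟨_, this⟩

/-- The middle edge of a closed walk of length `2 * m + 1` has both ends at distance `m` from the
base point. If `m` is even, crossing that edge makes both distances the odd number `m + 1`. -/
theorem exists_odd_walk_half [Fintype ι] [Nonempty ι] (ht : ∀ a, t (fun _ => a) = a) (m : ℕ)
    (hm : ∀ (B : Set W) (E : W → W → Prop), SymmAbsorbing t B E → (∃ x y, E x y) →
      ∃ z, Walk E (2 * m + 1) z z) :
    ∀ (B : Set W) (E : W → W → Prop), SymmAbsorbing t B E → (∃ x y, E x y) →
      ∃ z, Walk E (2 * (m / 2) + 1) z z := by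
  intro B E h hE
  refine exists_walk_self ht (2 * (m / 2)) ?_ h hE
  intro B E h hE
  obtain ⟨x, hx⟩ := hm B E h hE
  have hxB : x ∈ B := h.walk_mem_right hx
  rw [show 2 * m + 1 = m + (1 + m) by ring] at hx
  obtain ⟨y, hy, hyx⟩ := walk_add.1 hx
  obtain ⟨z, hyz, hzx⟩ := walk_add.1 hyx
  have hyz' := walk_one.1 hyz
  rcases Nat.even_or_odd' m with ⟨l, hl | hl⟩
  · have h2 : 2 * (m / 2) + 1 = m + 1 := by omega
    rw [h2]
    refine ⟨x, z, y, hxB, walk_add.2 ⟨y, hy, hyz⟩, ?_, h.symm _ _ hyz'⟩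
    exact walk_add.2 ⟨z, Walk.symm h.symm hzx, walk_one.2 (h.symm _ _ hyz')⟩
  · have h2 : 2 * (m / 2) + 1 = m := by omega
    rw [h2]
    exact ⟨x, y, z, hxB, hy, Walk.symm h.symm hzx, hyz'⟩

/-- A nonempty symmetric relation that is absorbing has a loop. -/
theorem exists_loop [Fintype ι] [Nonempty ι] (ht : ∀ a, t (fun _ => a) = a)
    (h : SymmAbsorbing t B E) {x y : W} (hxy : E x y) : ∃ z, E z z := by
  have key : ∀ m, (∀ (B : Set W) (E : W → W → Prop), SymmAbsorbing t B E → (∃ x y, E x y) →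
      ∃ z, Walk E (2 * m + 1) z z) → ∃ z, E z z := by
    intro m
    induction m using Nat.strong_induction_on with
    | _ m ih =>
      intro hm
      rcases Nat.eq_zero_or_pos m with rfl | hpos
      · obtain ⟨z, hz⟩ := hm B E h ⟨x, y, hxy⟩
        exact ⟨z, walk_one.1 hz⟩
      · exact ih _ (Nat.div_lt_self hpos one_lt_two) (exists_odd_walk_half ht m hm)
  exact key _ fun B E h ⟨x, y, hxy⟩ => h.exists_odd_walk ht hxy

end SymmAbsorbing

/-! ### The algebra of binary term operations -/

section BinaryOperations

variable {L : FirstOrder.Language.{u, v}} {A : Type a} [L.Structure A]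

/-- The operation of the algebra of binary functions on `A` given by a term. -/
def pointwise {κ : Type*} (p : L.Term κ) (c : κ → A → A → A) : A → A → A :=
  fun x y => p.realize fun k => c k x y

/-- The two binary projections. -/
def proj (b : Bool) (x y : A) : A := bif b then x else y

/-- Exchange the two arguments of a binary function. -/
def swapArgs (f : A → A → A) : A → A → A := fun x y => f y x

/-- The binary function `f(g(x, y), g(y, x))`. -/
def star (f g : A → A → A) : A → A → A := fun x y => f (g x y) (g y x)

/-- The function `f` or the function `f` with exchanged arguments. -/
def orient (f : A → A → A) (b : Bool) : A → A → A := bif b then f else swapArgs f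

theorem IdempotentAlgebra.realize_const (hA : IdempotentAlgebra L A) {κ : Type*} (p : L.Term κ)
    (x : A) : p.realize (fun _ => x) = x := by
  induction p with
  | var => rfl
  | func f ts ih => simpa only [FirstOrder.Language.Term.realize_func, ih] using hA _ f x

theorem pointwise_const (hA : IdempotentAlgebra L A) {κ : Type*} (p : L.Term κ)
    (f : A → A → A) : pointwise p (fun _ => f) = f := by
  ext x y; exact hA.realize_const p _

theorem swapArgs_pointwise {κ : Type*} (p : L.Term κ) (c : κ → A → A → A) :
    swapArgs (pointwise p c) = pointwise p fun k => swapArgs (c k) := rfl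

theorem star_pointwise {κ : Type*} (p : L.Term κ) (c : κ → A → A → A) (g : A → A → A) :
    star (pointwise p c) g = pointwise p fun k => star (c k) g := rfl

theorem star_proj (b : Bool) (g : A → A → A) : star (proj b) g = orient g b := by
  cases b <;> rfl

theorem star_pointwise_proj {κ : Type*} (p : L.Term κ) (u : κ → Bool) (g : A → A → A) :
    star (pointwise p fun k => proj (u k)) g = pointwise p fun k => orient g (u k) := by
  rw [star_pointwise]; simp only [star_proj]

theorem swapArgs_proj (b : Bool) : swapArgs (proj b : A → A → A) = proj !b := by
  cases b <;> rfl

theorem orient_proj (α β : Bool) : orient (proj α : A → A → A) β = proj (α ^^ !β) := by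
  cases α <;> cases β <;> rfl

theorem orient_pointwise {κ : Type*} (p : L.Term κ) (c : κ → A → A → A) (b : Bool) :
    orient (pointwise p c) b = pointwise p fun k => orient (c k) b := by
  cases b <;> rfl

variable (L)

/-- The subalgebra of a power of the algebra of binary functions that is generated by tuples of
projections, the columns of the matrix `M`. -/
def Span {m κ : Type*} (M : m → κ → Bool) (w : m → A → A → A) : Prop :=
  ∃ p : L.Term κ, ∀ i, w i = pointwise p fun k => proj (M i k)

/-- `f` is a binary term operation. -/
def IsBinaryTermOp (f : A → A → A) : Prop :=
  ∃ p : L.Term Bool, f = pointwise p proj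

variable {L}

namespace Span

variable {m κ : Type*} {M : m → κ → Bool}

theorem column (k : κ) : Span L M fun i => (proj (M i k) : A → A → A) :=
  ⟨.var k, fun _ => rfl⟩

theorem closed {κ' : Type*} (p : L.Term κ') {w : κ' → m → A → A → A} (h : ∀ k, Span L M (w k)) :
    Span L M fun i => pointwise p fun k => w k i := by
  choose q hq using h
  refine ⟨p.subst q, fun i => ?_⟩
  ext x y
  simp [pointwise, hq]

theorem induction {P : (m → A → A → A) → Prop} (hcol : ∀ k, P fun i => proj (M i k))
    (hcl : ∀ (p : L.Term κ) (w : κ → m → A → A → A), (∀ k, P (w k)) →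
      P fun i => pointwise p fun k => w k i) {w : m → A → A → A} (h : Span L M w) : P w := by
  obtain ⟨p, hp⟩ := h
  rw [funext hp]
  exact hcl p _ hcol

theorem isBinaryTermOp {w : m → A → A → A} (h : Span L M w) (i : m) : IsBinaryTermOp L (w i) := by
  obtain ⟨p, hp⟩ := h
  refine ⟨p.relabel (M i), ?_⟩
  rw [hp]; ext x y; simp [pointwise, Function.comp_def]

end Span

namespace IsBinaryTermOp

theorem proj (b : Bool) : IsBinaryTermOp L (proj b : A → A → A) := ⟨.var b, rfl⟩

theorem closed {κ : Type*} (p : L.Term κ) {w : κ → A → A → A} (h : ∀ k, IsBinaryTermOp L (w k)) :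
    IsBinaryTermOp L (pointwise p w) := by
  choose q hq using h
  refine ⟨p.subst q, ?_⟩
  ext x y
  simp [pointwise, hq]

theorem orient {f : A → A → A} (h : IsBinaryTermOp L f) (b : Bool) :
    IsBinaryTermOp L (orient f b) := by
  obtain ⟨p, rfl⟩ := h
  rw [orient_pointwise]
  exact closed p fun k => by rw [orient_proj]; exact proj _

theorem star {f g : A → A → A} (hf : IsBinaryTermOp L f) (hg : IsBinaryTermOp L g) :
    IsBinaryTermOp L (star f g) := by
  obtain ⟨p, rfl⟩ := hf
  rw [star_pointwise_proj p (fun k => k)]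
  exact closed p fun k => hg.orient k

end IsBinaryTermOp

end BinaryOperations

/-! ### Double loops from Taylor terms -/

section DoubleLoop

/-- The four rows of the double loop equations, with `true` for `x` and `false` for `y`. -/
def doubleLoopRows : Fin 4 → Fin 12 → Bool :=
  ![![true, true, true, true, true, true, false, false, false, false, false, false],
    ![true, true, false, false, false, false, true, true, true, true, false, false],
    ![true, false, true, true, false, false, true, true, false, false, true, false],
    ![false, true, true, false, true, false, true, false, true, false, false, true] ]

variable {L : FirstOrder.Language.{u, v}} {A : Type a} [L.Structure A]

variable (L) in
/-- The quaternary relation on binary functions that is generated by the columns of the double loop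
equations. -/
def DoubleLoopRel (f g h k : A → A → A) : Prop := Span L doubleLoopRows ![f, g, h, k]

theorem exists_doubleLoopRows : ∀ α β γ δ : Bool, α ≠ β ∨ γ ≠ δ → ∃ k : Fin 12,
    doubleLoopRows 0 k = α ∧ doubleLoopRows 1 k = β ∧ doubleLoopRows 2 k = γ ∧
      doubleLoopRows 3 k = δ := by
  decide

theorem doubleLoopRows_ne : ∀ k : Fin 12, doubleLoopRows 0 k ≠ doubleLoopRows 1 k ∨
    doubleLoopRows 2 k ≠ doubleLoopRows 3 k := by
  decide

theorem pointwise_doubleLoopRows_zero (d : L.Term (Fin 12)) (x y : A) :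
    pointwise d (fun k => proj (doubleLoopRows 0 k)) x y =
      d.realize ![x, x, x, x, x, x, y, y, y, y, y, y] :=
  congrArg d.realize (by ext j; fin_cases j <;> rfl)

theorem pointwise_doubleLoopRows_one (d : L.Term (Fin 12)) (x y : A) :
    pointwise d (fun k => proj (doubleLoopRows 1 k)) x y =
      d.realize ![x, x, y, y, y, y, x, x, x, x, y, y] :=
  congrArg d.realize (by ext j; fin_cases j <;> rfl)

theorem pointwise_doubleLoopRows_two (d : L.Term (Fin 12)) (x y : A) :
    pointwise d (fun k => proj (doubleLoopRows 2 k)) x y =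
      d.realize ![x, y, x, x, y, y, x, x, y, y, x, y] :=
  congrArg d.realize (by ext j; fin_cases j <;> rfl)

theorem pointwise_doubleLoopRows_three (d : L.Term (Fin 12)) (x y : A) :
    pointwise d (fun k => proj (doubleLoopRows 3 k)) x y =
      d.realize ![y, x, x, y, x, y, x, y, x, y, y, x] :=
  congrArg d.realize (by ext j; fin_cases j <;> rfl)

namespace DoubleLoopRel

theorem proj {α β γ δ : Bool} (h : α ≠ β ∨ γ ≠ δ) :
    DoubleLoopRel L (proj α : A → A → A) (proj β) (proj γ) (proj δ) := by
  obtain ⟨k, rfl, rfl, rfl, rfl⟩ := exists_doubleLoopRows α β γ δ h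
  unfold DoubleLoopRel
  convert Span.column (L := L) (A := A) (M := doubleLoopRows) k using 1
  ext i; fin_cases i <;> rfl

theorem closed {κ : Type*} (p : L.Term κ) {f g h k : κ → A → A → A}
    (hr : ∀ j, DoubleLoopRel L (f j) (g j) (h j) (k j)) :
    DoubleLoopRel L (pointwise p f) (pointwise p g) (pointwise p h) (pointwise p k) := by
  unfold DoubleLoopRel
  convert Span.closed p hr using 1
  ext i; fin_cases i <;> rfl

theorem induction {P : (A → A → A) → (A → A → A) → (A → A → A) → (A → A → A) → Prop}
    (hproj : ∀ α β γ δ : Bool, α ≠ β ∨ γ ≠ δ →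
      P (EqCond.proj α) (EqCond.proj β) (EqCond.proj γ) (EqCond.proj δ))
    (hcl : ∀ (p : L.Term (Fin 12)) (f g h k : Fin 12 → A → A → A),
      (∀ j, P (f j) (g j) (h j) (k j)) →
      P (pointwise p f) (pointwise p g) (pointwise p h) (pointwise p k))
    {f g h k : A → A → A} (hr : DoubleLoopRel L f g h k) : P f g h k :=
  Span.induction (P := fun w => P (w 0) (w 1) (w 2) (w 3))
    (fun j => hproj _ _ _ _ (doubleLoopRows_ne j))
    (fun p _ hw => hcl p _ _ _ _ hw) hr

theorem isBinaryTermOp {f g h k : A → A → A} (hr : DoubleLoopRel L f g h k) :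
    IsBinaryTermOp L f ∧ IsBinaryTermOp L g ∧ IsBinaryTermOp L h ∧ IsBinaryTermOp L k :=
  ⟨Span.isBinaryTermOp hr 0, Span.isBinaryTermOp hr 1, Span.isBinaryTermOp hr 2,
    Span.isBinaryTermOp hr 3⟩

theorem symm_right {f g h k : A → A → A} (hr : DoubleLoopRel L f g h k) :
    DoubleLoopRel L f g k h :=
  induction (P := fun f g h k => DoubleLoopRel L f g k h)
    (fun _ _ _ _ hne => proj (hne.imp id Ne.symm)) (fun p _ _ _ _ hw => closed p hw) hr

theorem swapArgs_right {f g h k : A → A → A} (hr : DoubleLoopRel L f g h k) :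
    DoubleLoopRel L f g (swapArgs h) (swapArgs k) :=
  induction (P := fun f g h k => DoubleLoopRel L f g (swapArgs h) (swapArgs k))
    (fun _ _ _ _ hne => by
      simp only [swapArgs_proj]; exact proj (hne.imp id fun h h' => h (by simpa using h')))
    (fun p _ _ _ _ hw => closed p hw) hr

/-- The generators impose only an inequality on the left pair, which survives exchanging x and y
there; so x and y may be replaced by c(x, y) and c(y, x) in the left pair alone. -/
theorem star_left (hA : IdempotentAlgebra L A) {c : A → A → A} (hc : IsBinaryTermOp L c)
    {f g h k : A → A → A} (hr : DoubleLoopRel L f g h k) :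
    DoubleLoopRel L (star f c) (star g c) h k := by
  refine induction (P := fun f g h k => DoubleLoopRel L (star f c) (star g c) h k) ?_
    (fun p _ _ _ _ hw => closed p hw) hr
  intro α β γ δ hne
  obtain ⟨p, rfl⟩ := hc
  simp only [star_proj, orient_pointwise, orient_proj]
  have := closed p fun j : Bool => proj (L := L) (A := A) (α := j ^^ !α) (β := j ^^ !β)
    (γ := γ) (δ := δ) (hne.imp (fun h h' => h (by simpa using h')) id)
  simpa only [pointwise_const hA] using this

theorem orient_left (hA : IdempotentAlgebra L A) {f g h k : A → A → A}
    (hr : DoubleLoopRel L f g h k) (b : Bool) :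
    DoubleLoopRel L (orient f b) (orient g b) h k := by
  cases b
  · exact hr.star_left hA (.proj false)
  · exact hr

/-- If the left projections differ, the right pair of a generator is arbitrary, so closure produces
arbitrary binary term operations on the right. -/
theorem of_orient_ne (hA : IdempotentAlgebra L A) {f h k : A → A → A} (hf : IsBinaryTermOp L f)
    (hh : IsBinaryTermOp L h) (hk : IsBinaryTermOp L k) {α β : Bool} (hne : α ≠ β) :
    DoubleLoopRel L (orient f α) (orient f β) h k := by
  obtain ⟨p, rfl⟩ := hf
  obtain ⟨q, rfl⟩ := hh
  obtain ⟨r, rfl⟩ := hk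
  have := closed p fun i : Bool => closed q fun j : Bool => closed r fun k : Bool =>
    proj (L := L) (A := A) (α := i ^^ !α) (β := i ^^ !β)
    (γ := j) (δ := k) (.inl fun h' => hne (by simpa using h'))
  simpa only [pointwise_const hA, orient_pointwise, orient_proj] using this

/-- Finitely many pairs that are related to the pair of some loop are related to a common loop. -/
theorem exists_common_loop (hA : IdempotentAlgebra L A) {ι : Type*} (s : Finset ι)
    (h k : ι → A → A → A) (hr : ∀ j ∈ s, ∃ f, DoubleLoopRel L f f (h j) (k j)) :
    ∃ f, IsBinaryTermOp L f ∧ ∀ j ∈ s, DoubleLoopRel L f f (h j) (k j) := by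
  classical
  induction s using Finset.induction_on with
  | empty => exact ⟨EqCond.proj true, .proj _, by simp⟩
  | insert i s hi ih =>
    obtain ⟨c, hc, hs⟩ := ih fun j hj => hr j (Finset.mem_insert_of_mem hj)
    obtain ⟨f, hf⟩ := hr i (Finset.mem_insert_self _ _)
    refine ⟨star f c, hf.isBinaryTermOp.1.star hc, fun j hj => ?_⟩
    rcases Finset.mem_insert.1 hj with rfl | hj
    · exact hf.star_left hA hc
    · obtain ⟨p, rfl⟩ := hf.isBinaryTermOp.1
      rw [star_pointwise_proj p fun b => b]
      have := closed p fun b : Bool => (hs j hj).orient_left hA b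
      simpa only [pointwise_const hA] using this

/-- A Taylor term yields a double loop. -/
theorem exists_double_loop (hA : IdempotentAlgebra L A) {ι : Type*} [Fintype ι] [Nonempty ι]
    (T : L.Term ι) (hT : ∀ i, ∃ u v : ι → Bool, u i ≠ v i ∧ ∀ x y : A,
      T.realize (fun j => EqCond.proj (u j) x y) = T.realize (fun j => EqCond.proj (v j) x y)) :
    ∃ f h : A → A → A, DoubleLoopRel L f f h h := by
  classical
  have habs : SymmAbsorbing (pointwise (A := A) T) {f | IsBinaryTermOp L f}
      fun h k => ∃ f, DoubleLoopRel L f f h k := by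
    refine ⟨fun c hc => .closed T hc, fun h k ⟨f, hf⟩ => hf.isBinaryTermOp.2.2.1,
      fun h k ⟨f, hf⟩ => ⟨f, hf.symm_right⟩, fun i h k hh hk hr => ?_⟩
    obtain ⟨f, hf, hr⟩ := exists_common_loop hA (Finset.univ.erase i) h k
      fun j hj => hr j (Finset.ne_of_mem_erase hj)
    -- The identity T(u) = T(v) makes the two left entries equal after applying T. At the free
    -- coordinate `i` the orientations of `f` differ, so no condition on `h i`, `k i` is needed.
    obtain ⟨u, v, huv, hT⟩ := hT i
    have key : ∀ j, DoubleLoopRel L (orient f (u j)) (orient f (v j)) (h j) (k j) := by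
      intro j
      by_cases hj : j = i
      · subst hj; exact of_orient_ne hA hf hh hk huv
      · have hrj := hr j (by simp [hj])
        by_cases he : u j = v j
        · rw [he]; exact hrj.orient_left hA _
        · exact of_orient_ne hA hf hrj.isBinaryTermOp.2.2.1 hrj.isBinaryTermOp.2.2.2 he
    have heq : pointwise T (fun j => orient f (u j)) = pointwise T (fun j => orient f (v j)) := by
      rw [← star_pointwise_proj, ← star_pointwise_proj]
      congr 1
      ext x y
      exact hT x y
    have := closed T key
    rw [heq] at this
    exact ⟨_, this⟩
  obtain ⟨h, f, hf⟩ := habs.exists_loop (fun f => pointwise_const hA T f)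
    (x := EqCond.proj true) (y := EqCond.proj false) ⟨EqCond.proj true, proj (.inr (by simp))⟩
  exact ⟨f, h, hf⟩

/-- With e = f(h(x, y), h(y, x)), both (e, e, h, h) and its version with h reversed lie in the
relation. Applying f to these two tuples leaves e on the left and creates e on the right. -/
theorem exists_strong_double_loop (hA : IdempotentAlgebra L A) {f h : A → A → A}
    (hr : DoubleLoopRel L f f h h) : ∃ e : A → A → A, DoubleLoopRel L e e e e := by
  obtain ⟨p, hp⟩ := hr.isBinaryTermOp.1
  have h1 := hr.star_left hA hr.isBinaryTermOp.2.2.1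
  have h2 : ∀ b, DoubleLoopRel L (star f h) (star f h) (orient h b) (orient h b) := by
    intro b; cases b
    · exact h1.swapArgs_right
    · exact h1
  have h3 := closed p h2
  rw [← star_pointwise_proj p fun b => b, ← hp, pointwise_const hA] at h3
  exact ⟨_, h3⟩

theorem iff_exists {f g h k : A → A → A} : DoubleLoopRel L f g h k ↔ ∃ d : L.Term (Fin 12),
    ∀ x y, f x y = d.realize ![x, x, x, x, x, x, y, y, y, y, y, y] ∧
      g x y = d.realize ![x, x, y, y, y, y, x, x, x, x, y, y] ∧
      h x y = d.realize ![x, y, x, x, y, y, x, x, y, y, x, y] ∧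
      k x y = d.realize ![y, x, x, y, x, y, x, y, x, y, y, x] := by
  refine exists_congr fun d => ?_
  simp only [Fin.forall_fin_succ, Matrix.cons_val_zero, Matrix.cons_val_succ, funext_iff]
  simp only [Fin.succ_zero_eq_one, Fin.succ_one_eq_two, IsEmpty.forall_iff, and_true,
    show (Fin.succ 2 : Fin 4) = 3 from rfl, pointwise_doubleLoopRows_zero,
    pointwise_doubleLoopRows_one, pointwise_doubleLoopRows_two, pointwise_doubleLoopRows_three]
  exact ⟨fun ⟨a, b, c, d⟩ x y => ⟨a x y, b x y, c x y, d x y⟩,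
    fun h => ⟨fun x y => (h x y).1, fun x y => (h x y).2.1, fun x y => (h x y).2.2.1,
      fun x y => (h x y).2.2.2⟩⟩

end DoubleLoopRel

theorem exists_isDoubleLoopTerm_iff : (∃ d : L.Term (Fin 12), IsDoubleLoopTerm A d) ↔
    ∃ f h : A → A → A, DoubleLoopRel L f f h h := by
  simp only [DoubleLoopRel.iff_exists]
  constructor
  · rintro ⟨d, hd⟩
    exact ⟨_, _, d, fun x y => ⟨rfl, (hd x y).1, rfl, (hd x y).2⟩⟩
  · rintro ⟨f, h, d, hd⟩
    refine ⟨d, fun x y => ?_⟩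
    obtain ⟨h1, h2, h3, h4⟩ := hd x y
    exact ⟨h1.symm.trans h2, h3.symm.trans h4⟩

theorem exists_isStrongDoubleLoopTerm_of_isDoubleLoopTerm (hA : IdempotentAlgebra L A)
    (h : ∃ d : L.Term (Fin 12), IsDoubleLoopTerm A d) :
    ∃ d : L.Term (Fin 12), IsStrongDoubleLoopTerm A d := by
  obtain ⟨f, g, hr⟩ := exists_isDoubleLoopTerm_iff.1 h
  obtain ⟨e, he⟩ := DoubleLoopRel.exists_strong_double_loop hA hr
  obtain ⟨d, hd⟩ := DoubleLoopRel.iff_exists.1 he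
  refine ⟨d, fun x y => ?_⟩
  obtain ⟨h1, h2, h3, h4⟩ := hd x y
  exact ⟨h1.symm.trans h2, h2.symm.trans h3, h3.symm.trans h4⟩

end DoubleLoop

/-! ### Constant triples by shifted words -/

section ThreeShifts

variable {W ι : Type*} {t : (ι → W) → W} {S : W → W → W → Prop}

/-- Labels of the words of length three such that three consecutive words of a sequence have a
label that is smaller than the other two, unless the first two words have period two. -/
theorem exists_word_label [Fintype ι] : ∃ (l : ι → ι → ι → ℕ) (M : ℕ),
    (∀ i j, l i j i = M) ∧ (∀ i j k, i ≠ k → l i j k < M) ∧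
    ∀ i₁ i₂ i₃ i₄ i₅, ¬ (i₁ = i₃ ∧ i₂ = i₄) →
      (l i₁ i₂ i₃ < l i₂ i₃ i₄ ∧ l i₁ i₂ i₃ < l i₃ i₄ i₅) ∨
      (l i₂ i₃ i₄ < l i₁ i₂ i₃ ∧ l i₂ i₃ i₄ < l i₃ i₄ i₅) ∨
      (l i₃ i₄ i₅ < l i₁ i₂ i₃ ∧ l i₃ i₄ i₅ < l i₂ i₃ i₄) := by
  classical
  obtain ⟨E, M, hE, hM⟩ : ∃ (E : ι × ι × ι → ℕ) (M : ℕ), (∀ p q, E p = E q → p = q) ∧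
      ∀ p, E p < M :=
    ⟨fun p => Fintype.equivFin _ p, _,
      fun p q h => (Fintype.equivFin _).injective (Fin.val_injective h),
      fun p => (Fintype.equivFin _ p).isLt⟩
  have hE' : ∀ i j k i' j' k', E (i, j, k) = E (i', j', k') → i = i' ∧ j = j' ∧ k = k' := by
    intro i j k i' j' k' h
    simpa using hE _ _ h
  -- Labels below `M` determine the word. Any two equal words among the three consecutive ones have
  -- equal first and last letters, hence label `M`; so the minimum is strict once some label is
  -- below `M`.
  refine ⟨fun i j k => if i = k then M else E (i, j, k), M, by simp, ?_, ?_⟩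
  · intro i j k h; simpa [h] using hM _
  · intro i₁ i₂ i₃ i₄ i₅ h
    have h12 := hE' i₁ i₂ i₃ i₂ i₃ i₄
    have h13 := hE' i₁ i₂ i₃ i₃ i₄ i₅
    have h23 := hE' i₂ i₃ i₄ i₃ i₄ i₅
    have h1 := hM (i₁, i₂, i₃)
    have h2 := hM (i₂, i₃, i₄)
    have h3 := hM (i₃, i₄, i₅)
    clear hE hM hE'
    dsimp only
    generalize E (i₁, i₂, i₃) = a at *
    generalize E (i₂, i₃, i₄) = b at *
    generalize E (i₃, i₄, i₅) = c at *
    split_ifs <;> grind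

/-- A ternary relation contains a constant triple when it is compatible with an operation `t` and
contains enough triples of elements `o n = t(u) = t(v)`, where `u` and `v` are tuples of elements
`z n true` and `z n false` that can be chosen to differ in any given coordinate. -/
theorem exists_const_triple [Fintype ι] (ht : ∀ a, t (fun _ => a) = a)
    (hS : ∀ c d e : ι → W, (∀ i, S (c i) (d i) (e i)) → S (t c) (t d) (t e))
    (hrot : ∀ a b c, S a b c → S b c a) (o : ℕ → W) (z : ℕ → Bool → W)
    (hrep : ∀ i n, ∃ u v : ι → Bool, u i ≠ v i ∧ t (fun j => z n (u j)) = o n ∧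
      t (fun j => z n (v j)) = o n)
    (hne : ∀ n r α β, α ≠ β → S (z n α) (z n β) (o r))
    (hz : ∀ n r, r < n → ∀ α β, S (z n α) (z n β) (o r))
    (ho : ∀ m n r, r < m → r < n → S (o m) (o n) (o r)) : ∃ s, S s s s := by
  obtain ⟨l, M, hM, hlt, hmin⟩ := exists_word_label (ι := ι)
  have hmono : ∀ {a b c : W} {f g h : ι → W}, t f = a → t g = b → t h = c →
      (∀ i, S (f i) (g i) (h i)) → S a b c := by
    rintro _ _ _ f g h rfl rfl rfl hfg; exact hS _ _ _ hfg
  let y : ι → ι → W := fun i j => t fun k => o (l i j k)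
  let x : ι → W := fun i => t fun j => y i j
  -- The entries unfold along `i₁ i₂ i₃`, `i₂ i₃ i₄` and `i₃ i₄ i₅`; an entry not involving the
  -- current index is treated as a constant tuple.
  refine ⟨t x, hmono rfl (ht _) (ht _) fun i₁ => hmono (f := fun j => y i₁ j) rfl rfl (ht _)
    fun i₂ => hmono (f := fun k => o (l i₁ i₂ k)) (g := fun j => y i₂ j) rfl rfl rfl
    fun i₃ => hmono (g := fun k => o (l i₂ i₃ k)) (h := fun j => y i₃ j) (ht _) rfl rfl
    fun i₄ => ?_⟩
  by_cases h : i₁ = i₃ ∧ i₂ = i₄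
  · obtain ⟨rfl, rfl⟩ := h
    rw [hM, hM]
    -- The first two labels are both `M`, so these entries are unfolded over `i₅` by two different
    -- representations. Where `u` and `v` agree, `i₅ ≠ i₁`, and the third label is below `M`.
    obtain ⟨u, v, huv, hu, hv⟩ := hrep i₁ M
    refine hmono hu hv rfl fun i₅ => ?_
    by_cases he : u i₅ = v i₅
    · exact hz _ _ (hlt _ _ _ fun hc => huv (by rw [hc]; exact he)) _ _
    · exact hne _ _ _ _ he
  · refine hmono (ht _) (ht _) rfl fun i₅ => ?_
    rcases hmin i₁ i₂ i₃ i₄ i₅ h with ⟨h1, h2⟩ | ⟨h1, h2⟩ | ⟨h1, h2⟩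
    · exact hrot _ _ _ (hrot _ _ _ (ho _ _ _ h1 h2))
    · exact hrot _ _ _ (ho _ _ _ h2 h1)
    · exact ho _ _ _ h1 h2

end ThreeShifts

/-! ### Weak 3-cube terms -/

section WeakCube

/-- The three rows of the weak 3-cube equations, with `true` for `x` and `false` for `y`. -/
def cubeRows : Fin 3 → Fin 6 → Bool :=
  ![![true, false, false, false, true, true],
    ![false, true, false, true, false, true],
    ![false, false, true, true, true, false] ]

variable {L : FirstOrder.Language.{u, v}} {A : Type a} [L.Structure A]

variable (L) in
/-- The ternary relation on binary functions that is generated by the columns of the weak 3-cube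
equations. -/
def CubeRel (f g h : A → A → A) : Prop := Span L cubeRows ![f, g, h]

theorem exists_cubeRows : ∀ α β γ : Bool, ¬ (α = β ∧ β = γ) → ∃ k : Fin 6,
    cubeRows 0 k = α ∧ cubeRows 1 k = β ∧ cubeRows 2 k = γ := by
  decide

theorem cubeRows_ne : ∀ k : Fin 6, ¬ (cubeRows 0 k = cubeRows 1 k ∧
    cubeRows 1 k = cubeRows 2 k) := by
  decide

namespace CubeRel

theorem proj {α β γ : Bool} (h : ¬ (α = β ∧ β = γ)) :
    CubeRel L (proj α : A → A → A) (proj β) (proj γ) := by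
  obtain ⟨k, rfl, rfl, rfl⟩ := exists_cubeRows α β γ h
  unfold CubeRel
  convert Span.column (L := L) (A := A) (M := cubeRows) k using 1
  ext i; fin_cases i <;> rfl

theorem closed {κ : Type*} (p : L.Term κ) {f g h : κ → A → A → A}
    (hr : ∀ j, CubeRel L (f j) (g j) (h j)) :
    CubeRel L (pointwise p f) (pointwise p g) (pointwise p h) := by
  unfold CubeRel
  convert Span.closed p hr using 1
  ext i; fin_cases i <;> rfl

theorem induction {P : (A → A → A) → (A → A → A) → (A → A → A) → Prop}
    (hproj : ∀ α β γ : Bool, ¬ (α = β ∧ β = γ) →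
      P (EqCond.proj α) (EqCond.proj β) (EqCond.proj γ))
    (hcl : ∀ (p : L.Term (Fin 6)) (f g h : Fin 6 → A → A → A), (∀ j, P (f j) (g j) (h j)) →
      P (pointwise p f) (pointwise p g) (pointwise p h))
    {f g h : A → A → A} (hr : CubeRel L f g h) : P f g h :=
  Span.induction (P := fun w => P (w 0) (w 1) (w 2))
    (fun j => hproj _ _ _ (cubeRows_ne j)) (fun p _ hw => hcl p _ _ _ hw) hr

theorem rotate {f g h : A → A → A} (hr : CubeRel L f g h) : CubeRel L g h f :=
  induction (P := fun f g h => CubeRel L g h f)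
    (fun _ _ _ hne => proj fun h' => hne ⟨(h'.1.trans h'.2).symm, h'.1⟩)
    (fun p _ _ _ hw => closed p hw) hr

theorem star {c : A → A → A} (hc : IsBinaryTermOp L c) {f g h : A → A → A}
    (hr : CubeRel L f g h) : CubeRel L (star f c) (star g c) (star h c) := by
  refine induction (P := fun f g h => CubeRel L (EqCond.star f c) (EqCond.star g c)
    (EqCond.star h c)) ?_ (fun p _ _ _ hw => closed p hw) hr
  intro α β γ hne
  obtain ⟨p, rfl⟩ := hc
  simp only [star_proj, orient_pointwise, orient_proj]
  exact closed p fun j : Bool => proj fun h => hne (by simpa using h)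

theorem star_iterate {c : A → A → A} (hc : IsBinaryTermOp L c) {f g h : A → A → A}
    (hr : CubeRel L f g h) (n : ℕ) :
    CubeRel L ((EqCond.star · c)^[n] f) ((EqCond.star · c)^[n] g) ((EqCond.star · c)^[n] h) := by
  induction n with
  | zero => exact hr
  | succ n ih => simp only [Function.iterate_succ_apply']; exact ih.star hc

theorem of_orient_ne (hA : IdempotentAlgebra L A) {f h : A → A → A} (hf : IsBinaryTermOp L f)
    (hh : IsBinaryTermOp L h) {α β : Bool} (hne : α ≠ β) :
    CubeRel L (orient f α) (orient f β) h := by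
  obtain ⟨p, rfl⟩ := hf
  obtain ⟨q, rfl⟩ := hh
  have := closed p fun i : Bool => closed q fun j : Bool =>
    proj (L := L) (A := A) (α := i ^^ !α) (β := i ^^ !β) (γ := j)
      fun h' => hne (by simpa using h'.1)
  simpa only [pointwise_const hA, orient_pointwise, orient_proj] using this

theorem of_orient (hA : IdempotentAlgebra L A) {f g h k l : A → A → A} (hf : IsBinaryTermOp L f)
    (hg : IsBinaryTermOp L g) (hk : IsBinaryTermOp L k) (hl : IsBinaryTermOp L l)
    (hh : IsBinaryTermOp L h)
    (h1 : CubeRel L f f g) (h2 : CubeRel L (swapArgs f) (swapArgs f) g) :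
    CubeRel L (EqCond.star k f) (EqCond.star l f) (EqCond.star h g) := by
  have key : ∀ α β γ, CubeRel L (orient f α) (orient f β) (orient g γ) := by
    intro α β γ
    by_cases hαβ : α = β
    · subst hαβ
      cases γ
      · cases α
        · exact h1.star (.proj false)
        · exact h2.star (.proj false)
      · cases α
        · exact h2
        · exact h1
    · exact of_orient_ne hA hf (hg.orient γ) hαβ
  obtain ⟨p, rfl⟩ := hk
  obtain ⟨q, rfl⟩ := hl
  obtain ⟨r, rfl⟩ := hh
  rw [star_pointwise_proj p fun b => b, star_pointwise_proj q fun b => b,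
    star_pointwise_proj r fun b => b]
  have := closed p fun i : Bool => closed q fun j : Bool => closed r fun k : Bool => key i j k
  simpa only [pointwise_const hA] using this

end CubeRel

theorem IsBinaryTermOp.star_iterate {c f : A → A → A} (hf : IsBinaryTermOp L f)
    (hc : IsBinaryTermOp L c) (n : ℕ) : IsBinaryTermOp L ((EqCond.star · c)^[n] f) := by
  induction n with
  | zero => exact hf
  | succ n ih => simp only [Function.iterate_succ_apply']; exact ih.star hc

theorem star_iterate_orient (c f : A → A → A) (b : Bool) (n : ℕ) :
    (star · c)^[n] (orient f b) = orient ((star · c)^[n] f) b := by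
  induction n with
  | zero => rfl
  | succ n ih => simp only [Function.iterate_succ_apply', ih]; cases b <;> rfl

theorem star_iterate_pointwise {κ : Type*} (p : L.Term κ) (f : κ → A → A → A) (c : A → A → A)
    (n : ℕ) : (star · c)^[n] (pointwise p f) = pointwise p fun k => (star · c)^[n] (f k) := by
  induction n with
  | zero => rfl
  | succ n ih => simp only [Function.iterate_succ_apply', ih]; rfl

/-- Composing with e(x, y), e(y, x) on the inside gives the sequence of elements required by
`exists_const_triple`. Deeper composition on the first two entries is absorbed by
`CubeRel.of_orient`; the four rows of the strong loop supply the different representations. -/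
theorem exists_cubeRel_const (hA : IdempotentAlgebra L A) {d : L.Term (Fin 12)}
    {e : A → A → A} (he : ∀ i, e = pointwise d fun k => proj (doubleLoopRows i k)) :
    ∃ s : A → A → A, CubeRel L s s s := by
  have hterm : ∀ u : Fin 12 → Bool, IsBinaryTermOp L (pointwise d fun k => (proj (u k) : A → A → A)) :=
    fun u => .closed d fun k => .proj _
  have heT : IsBinaryTermOp L e := by rw [he 0]; exact hterm _
  -- `w` negates the common value of rows 0 and 1 where they agree, and equals rows 2 and 3 where
  -- those agree, since there the rows are used with x and y exchanged. The remaining four entries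
  -- are free.
  let w : Fin 12 → Bool := ![false, false, true, true, false, false, true, true, false, false,
    true, true]
  let b : A → A → A := pointwise d fun k => proj (w k)
  have hb : IsBinaryTermOp L b := hterm w
  have h1 : CubeRel L e e b := by
    nth_rewrite 1 [he 0]
    rw [he 1]
    refine CubeRel.closed d fun k => CubeRel.proj ?_
    revert k; decide
  have h2 : CubeRel L (swapArgs e) (swapArgs e) b := by
    nth_rewrite 1 [he 2]
    rw [he 3]
    simp only [swapArgs_pointwise, swapArgs_proj]
    refine CubeRel.closed d fun k => CubeRel.proj ?_
    revert k; decide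
  have hrep : ∀ i n, (star · e)^[n] (star e b) = pointwise d fun k =>
      orient ((star · e)^[n] b) (doubleLoopRows i k) := by
    intro i n
    nth_rewrite 2 [he i]
    rw [star_pointwise_proj, star_iterate_pointwise]
    simp only [star_iterate_orient]
  have hlt : ∀ m n r, r < m → r < n → ∀ f g : A → A → A, IsBinaryTermOp L f →
      IsBinaryTermOp L g → CubeRel L ((star · e)^[m] f) ((star · e)^[n] g)
        ((star · e)^[r] (star e b)) := by
    intro m n r hm hn f g hf hg
    obtain ⟨m, rfl⟩ := Nat.exists_eq_add_of_lt hm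
    obtain ⟨n, rfl⟩ := Nat.exists_eq_add_of_lt hn
    have hsplit : ∀ (k : ℕ) (f : A → A → A), (star · e)^[r + k + 1] f =
        (star · e)^[r] ((star · e)^[k + 1] f) := fun k f => by
      rw [Nat.add_assoc, Function.iterate_add_apply]
    rw [hsplit, hsplit]
    refine CubeRel.star_iterate heT ?_ r
    rw [Function.iterate_succ_apply', Function.iterate_succ_apply']
    exact CubeRel.of_orient hA heT hb (hf.star_iterate heT _) (hg.star_iterate heT _) heT h1 h2
  refine exists_const_triple (t := pointwise d) (fun f => pointwise_const hA d f)
    (fun _ _ _ h => CubeRel.closed d h) (fun _ _ _ h => h.rotate)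
    (fun n => (star · e)^[n] (star e b)) (fun n => orient ((star · e)^[n] b)) ?_ ?_ ?_ ?_
  · intro k n
    rcases doubleLoopRows_ne k with hk | hk
    · exact ⟨_, _, hk, (hrep _ _).symm, (hrep _ _).symm⟩
    · exact ⟨_, _, hk, (hrep _ _).symm, (hrep _ _).symm⟩
  · intro n r α β hne
    exact CubeRel.of_orient_ne hA (hb.star_iterate heT n) ((heT.star hb).star_iterate heT r) hne
  · intro n r hr α β
    rw [← star_iterate_orient, ← star_iterate_orient]
    exact hlt _ _ _ hr hr _ _ (hb.orient _) (hb.orient _)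
  · intro m n r hm hn
    exact hlt _ _ _ hm hn _ _ (heT.star hb) (heT.star hb)

theorem exists_isWeakThreeCubeTerm_of_isStrongDoubleLoopTerm (hA : IdempotentAlgebra L A)
    (h : ∃ d : L.Term (Fin 12), IsStrongDoubleLoopTerm A d) :
    ∃ t : L.Term (Fin 6), IsWeakThreeCubeTerm A t := by
  obtain ⟨d, hd⟩ := h
  have he : ∀ i, (pointwise d fun k => proj (doubleLoopRows 0 k) : A → A → A) =
      pointwise d fun k => proj (doubleLoopRows i k) := by
    intro i
    ext x y
    obtain ⟨h1, h2, h3⟩ := hd x y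
    simp only [← pointwise_doubleLoopRows_zero, ← pointwise_doubleLoopRows_one,
      ← pointwise_doubleLoopRows_two, ← pointwise_doubleLoopRows_three] at h1 h2 h3
    fin_cases i
    · rfl
    · exact h1
    · exact h1.trans h2
    · exact (h1.trans h2).trans h3
  obtain ⟨s, t, ht⟩ := exists_cubeRel_const hA he
  have h0 : ∀ x y : A, (fun j => proj (cubeRows 0 j) x y) = ![x, y, y, y, x, x] := by
    intro x y; ext j; fin_cases j <;> rfl
  have h1 : ∀ x y : A, (fun j => proj (cubeRows 1 j) x y) = ![y, x, y, x, y, x] := by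
    intro x y; ext j; fin_cases j <;> rfl
  have h2 : ∀ x y : A, (fun j => proj (cubeRows 2 j) x y) = ![y, y, x, x, x, y] := by
    intro x y; ext j; fin_cases j <;> rfl
  refine ⟨t, fun x y => ?_⟩
  have e0 : s x y = _ := congrFun (congrFun (ht 0) x) y
  have e1 : s x y = _ := congrFun (congrFun (ht 1) x) y
  have e2 : s x y = _ := congrFun (congrFun (ht 2) x) y
  simp only [pointwise, h0, h1, h2] at e0 e1 e2
  exact ⟨e0.symm.trans e1, e1.symm.trans e2⟩

end WeakCube

/-! ### Coherent choices of variables and triviality -/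

section CoherentChoice

variable {L : FirstOrder.Language.{u, v}} {A : Type a} [L.Structure A]

theorem IdempotentAlgebra.nonempty_index (hA : IdempotentAlgebra L A) [Nontrivial A] {ι : Type*}
    (T : L.Term ι) : Nonempty ι := by
  by_contra h
  rw [not_nonempty_iff] at h
  obtain ⟨x, y, hxy⟩ := exists_pair_ne A
  refine hxy ?_
  rw [← hA.realize_const T x, ← hA.realize_const T y]
  exact congrArg T.realize (funext fun i => h.elim i)

/-- If `A` has no Taylor operation, then every term has a variable that is respected by
all identities between two terms obtained from it by renaming of variables. -/
theorem exists_stable_variable (hA : IdempotentAlgebra L A) [Nontrivial A]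
    (hd : ¬ ∃ f h : A → A → A, DoubleLoopRel L f f h h) (T : L.Term ℕ) :
    ∃ i : ℕ, ∀ π σ : ℕ → ℕ, (∀ z : ℕ → A, T.realize (z ∘ π) = T.realize (z ∘ σ)) → π i = σ i := by
  have hr : ∀ z : ℕ → A, (T.restrictVar id).realize (fun j : T.varFinset => z j) = T.realize z := fun z =>
    FirstOrder.Language.Term.realize_restrictVar z (fun _ => rfl)
  have := hA.nonempty_index (T.restrictVar (id : T.varFinset → _))
  by_contra hi
  push Not at hi
  refine hd (DoubleLoopRel.exists_double_loop hA (T.restrictVar (id : T.varFinset → _)) fun i => ?_)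
  obtain ⟨π, σ, hT, hne⟩ := hi i
  refine ⟨fun j => decide (π j = π i), fun j => decide (σ j = π i), by simp [hne.symm], ?_⟩
  intro x y
  have hz := hT fun k => proj (decide (k = π i)) x y
  exact (hr _).trans (hz.trans (hr _).symm)

/-- Finitely many terms of an idempotent algebra arise from a single term by renaming of
variables. -/
theorem exists_common_term (hA : IdempotentAlgebra L A) (s : Finset (L.Term ℕ)) :
    ∃ T : L.Term ℕ, ∀ p ∈ s, ∃ π : ℕ → ℕ, ∀ z : ℕ → A, T.realize (z ∘ π) = p.realize z := by
  classical
  induction s using Finset.induction_on with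
  | empty => exact ⟨.var 0, by simp⟩
  | insert g s _ ih =>
    obtain ⟨T, hT⟩ := ih
    -- By idempotence, g composed with copies of T becomes g when each copy is collapsed to one
    -- variable, and T when all copies are identified.
    refine ⟨g.subst fun j => T.relabel fun k => Nat.pair j k, fun p hp => ?_⟩
    rcases Finset.mem_insert.1 hp with rfl | hp
    · refine ⟨fun n => n.unpair.1, fun z => ?_⟩
      simp only [FirstOrder.Language.Term.realize_subst, FirstOrder.Language.Term.realize_relabel,
        Function.comp_def, Nat.unpair_pair, hA.realize_const]
    · obtain ⟨π, hπ⟩ := hT p hp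
      refine ⟨fun n => π n.unpair.2, fun z => ?_⟩
      rw [← hπ z]
      simp only [FirstOrder.Language.Term.realize_subst, FirstOrder.Language.Term.realize_relabel,
        Function.comp_def, Nat.unpair_pair, hA.realize_const]

/-- A choice of variables of all terms that respects all identities between two terms obtained
by renaming of variables. -/
def IsCoherentChoice (A : Type a) [L.Structure A] (χ : L.Term ℕ → ℕ) : Prop :=
  ∀ (p q : L.Term ℕ) (π σ : ℕ → ℕ), (∀ z : ℕ → A, p.realize (z ∘ π) = q.realize (z ∘ σ)) →
    π (χ p) = σ (χ q)

/-- For a finite set of terms, a stable variable of their common term descends along the renamings.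
Rado selection glues these partial choices; the retraction `r` onto the variables of each term gives
it the finite ranges that it needs. -/
theorem exists_isCoherentChoice (hA : IdempotentAlgebra L A) [Nontrivial A]
    (hd : ¬ ∃ f h : A → A → A, DoubleLoopRel L f f h h) :
    ∃ χ : L.Term ℕ → ℕ, IsCoherentChoice A χ := by
  classical
  have hr : ∀ (p : L.Term ℕ) (z : ℕ → A),
      (p.restrictVar id).realize (fun j : p.varFinset => z j) = p.realize z := fun p z =>
    FirstOrder.Language.Term.realize_restrictVar z (fun _ => rfl)
  have hne : ∀ p : L.Term ℕ, Nonempty p.varFinset := fun p =>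
    hA.nonempty_index (p.restrictVar (id : p.varFinset → _))
  have hret : ∀ p : L.Term ℕ, ∃ r : ℕ → p.varFinset, ∀ z : ℕ → A,
      p.realize (fun n => z (r n)) = p.realize z := by
    intro p
    refine ⟨fun n => if h : n ∈ p.varFinset then ⟨n, h⟩ else Classical.choice (hne p), fun z => ?_⟩
    rw [← hr, ← hr p z]
    congr 1
    ext j
    simp
  choose r hr using hret
  choose T ρ hρ using exists_common_term (L := L) (A := A) hA
  choose i hi using exists_stable_variable hA hd
  obtain ⟨χ, hχ⟩ := Finset.rado_selection fun (s : Finset (L.Term ℕ)) (p : L.Term ℕ) =>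
    if h : p ∈ s then r p (ρ s p h (i (T s))) else Classical.choice (hne p)
  refine ⟨fun p => χ p, fun p q π σ h => ?_⟩
  obtain ⟨t, ht, hχt⟩ := hχ {p, q}
  have hp : p ∈ t := ht (by simp)
  have hq : q ∈ t := ht (by simp)
  have key : ∀ (p : L.Term ℕ) (hp : p ∈ t) (π : ℕ → ℕ) (z : ℕ → A),
      (T t).realize (z ∘ fun n => π (r p (ρ t p hp n))) = p.realize (z ∘ π) := fun p hp π z =>
    (hρ t p hp fun n => z (π (r p n))).trans (hr p (z ∘ π))
  have := hi (T t) _ _ fun z => (key p hp π z).trans ((h z).trans (key q hq σ z).symm)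
  dsimp only
  rw [hχt p (by simp), hχt q (by simp), dif_pos hp, dif_pos hq]
  exact this

namespace IsCoherentChoice

variable {χ : L.Term ℕ → ℕ}

theorem apply_var (hχ : IsCoherentChoice A χ) (n : ℕ) : χ (.var n) = n :=
  hχ (.var n) (.var n) id (fun _ => n) fun _ => rfl

/-- Shifting all variables from `n` on does not change the term, so coherence excludes choosing any
of them. -/
theorem apply_lt (hχ : IsCoherentChoice A χ) {n : ℕ} (f : L.Term (Fin n)) :
    χ (f.relabel Fin.val) < n := by
  have h := hχ (f.relabel Fin.val) (f.relabel Fin.val) id (fun k => if k < n then k else k + 1)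
    fun z => by
      simp only [FirstOrder.Language.Term.realize_relabel]
      congr 1
      ext k
      simp
  by_contra hn
  simp [hn] at h

theorem apply_subst (hA : IdempotentAlgebra L A) (hχ : IsCoherentChoice A χ) {n : ℕ}
    (f : L.Term (Fin n)) (p : Fin n → L.Term ℕ) :
    χ (f.subst p) = χ (p ⟨χ (f.relabel Fin.val), hχ.apply_lt f⟩) := by
  classical
  obtain ⟨T, hT⟩ := exists_common_term (A := A) hA (Finset.univ.image p)
  have hT' : ∀ j : Fin n, ∃ π : ℕ → ℕ, ∀ z : ℕ → A, T.realize (z ∘ π) = (p j).realize z :=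
    fun j => hT _ (Finset.mem_image_of_mem _ (Finset.mem_univ j))
  choose ρ hρ using hT'
  -- All `p j` are renamings of `T`, so the substituted term is a renaming of `G`. Collapsing `G`
  -- onto `f` and onto `T` determines both coordinates of its chosen variable.
  let G : L.Term ℕ := f.subst fun j => T.relabel fun k => Nat.pair j k
  have h1 : (χ G).unpair.1 = χ (f.relabel Fin.val) :=
    hχ G (f.relabel Fin.val) (fun n => n.unpair.1) id fun z => by
      simp only [G, FirstOrder.Language.Term.realize_subst, Function.comp_def, id,
        FirstOrder.Language.Term.realize_relabel, Nat.unpair_pair, hA.realize_const]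
  have h2 : (χ G).unpair.2 = χ T := hχ G T (fun n => n.unpair.2) id fun z => by
    simp only [G, FirstOrder.Language.Term.realize_subst, Function.comp_def, id,
      FirstOrder.Language.Term.realize_relabel, Nat.unpair_pair, hA.realize_const]
  let τ : ℕ → ℕ := fun m => if h : m.unpair.1 < n then ρ ⟨_, h⟩ m.unpair.2 else 0
  have h3 : χ (f.subst p) = τ (χ G) := hχ (f.subst p) G id τ fun z => by
    simp only [G, FirstOrder.Language.Term.realize_subst, Function.comp_id,
      FirstOrder.Language.Term.realize_relabel]
    congr 1
    ext j
    rw [← hρ j]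
    congr 1
    ext k
    simp [τ]
  have h4 : ∀ j, χ (p j) = ρ j (χ T) := fun j => hχ (p j) T id (ρ j) fun z => (hρ j z).symm
  rw [h3, h4]
  simp only [τ, h1, h2, hχ.apply_lt, dif_pos]

/-- A condition satisfied by an idempotent algebra without Taylor operations is satisfied by
projections. -/
theorem isTrivialCondition (hA : IdempotentAlgebra L A) (hχ : IsCoherentChoice A χ)
    {D : FirstOrder.Language.{w, 0}} {S : Set (Equation D)} (hS : Satisfies S L A) :
    IsTrivialCondition S := by
  obtain ⟨I, hI⟩ := hS
  intro L' _ B _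
  let J : ∀ n : ℕ, D.Functions n → L'.Term (Fin n) := fun n f =>
    .var ⟨χ ((I n f).relabel Fin.val), hχ.apply_lt _⟩
  have hJ : ∀ (s : D.Term ℕ) (z : ℕ → B), (s.substFunc fun {n} f => J n f).realize z =
      z (χ (s.substFunc fun {n} f => I n f)) := by
    intro s z
    induction s with
    | var n => exact congrArg z (hχ.apply_var n).symm
    | func f ts ih =>
      exact (ih _).trans (congrArg z (hχ.apply_subst hA (I _ f) fun j => (ts j).substFunc fun {n} f => I n f).symm)
  refine ⟨J, fun e he z => ?_⟩
  exact (hJ _ _).trans ((congrArg z (hχ _ _ id id (hI e he))).trans (hJ _ _).symm)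

end IsCoherentChoice

theorem exists_isDoubleLoopTerm_of_isTaylor (hA : IdempotentAlgebra L A)
    (h : IsTaylor.{u, v, a, w} L A) : ∃ d : L.Term (Fin 12), IsDoubleLoopTerm A d := by
  rcases subsingleton_or_nontrivial A with hs | hn
  · exact ⟨.var 0, fun x y => ⟨Subsingleton.elim _ _, Subsingleton.elim _ _⟩⟩
  · rw [exists_isDoubleLoopTerm_iff]
    by_contra hd
    obtain ⟨χ, hχ⟩ := exists_isCoherentChoice hA hd
    obtain ⟨D, _, S, _, hS, hSA⟩ := h
    exact hS (hχ.isTrivialCondition hA hSA)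

end CoherentChoice

/-! ### Identities between renamed terms -/

section Minors

variable {L : FirstOrder.Language.{u, v}} {A : Type a} [L.Structure A]

/-- Symbols of arity `r` indexed by `K`. -/
def symbolLanguage (K : Type) (r : ℕ) : FirstOrder.Language.{w, 0} :=
  ⟨fun n => ULift.{w} (PLift (n = r) × K), fun _ => Empty⟩

/-- The equation `k(π) ≈ k'(π')` between two symbols applied to variables. -/
def minorEquation {K : Type} {r : ℕ} (k k' : K) (π π' : Fin r → ℕ) :
    Equation (symbolLanguage.{w} K r) :=
  (.func (l := r) ⟨⟨rfl⟩, k⟩ fun j => .var (π j), .func (l := r) ⟨⟨rfl⟩, k'⟩ fun j => .var (π' j))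

/-- An idempotent algebra is Taylor if it has terms such that no choice of variables of these
terms respects all identities between terms obtained from them by renaming of variables. -/
theorem isTaylor_of_minors (hA : IdempotentAlgebra L A) {K : Type} {r : ℕ}
    (τ : K → L.Term (Fin r))
    (hτ : ∀ ι : K → Fin r, ∃ (k k' : K) (π π' : Fin r → ℕ),
      (∀ z : ℕ → A, (τ k).realize (z ∘ π) = (τ k').realize (z ∘ π')) ∧ π (ι k) ≠ π' (ι k')) :
    IsTaylor.{u, v, a, w} L A := by
  let S : Set (Equation (symbolLanguage.{w} K r)) := {e |
    (∃ (k k' : K) (π π' : Fin r → ℕ), (∀ z : ℕ → A, (τ k).realize (z ∘ π) =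
      (τ k').realize (z ∘ π')) ∧ e = minorEquation k k' π π') ∨
    ∃ (n : ℕ) (f : (symbolLanguage.{w} K r).Functions n), e = idempotencyEquation f}
  refine ⟨symbolLanguage.{w} K r, fun _ => inferInstanceAs (IsEmpty Empty), S, ?_, ?_, ?_⟩
  · exact fun n f B _ hB => hB _ (.inr ⟨n, f, rfl⟩)
  · intro hS
    -- Without operations every term is a variable, so an interpretation is a choice of coordinates,
    -- and two elements suffice to refute it.
    let L' : FirstOrder.Language.{w, 0} := ⟨fun _ => PEmpty, fun _ => Empty⟩
    have : L'.IsAlgebraic := fun _ => inferInstanceAs (IsEmpty Empty)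
    let _ : L'.Structure (ULift.{w} Bool) := ⟨fun f => f.elim, fun f => f.elim⟩
    obtain ⟨I, hI⟩ := hS L' (ULift.{w} Bool)
    have hvar : ∀ t : L'.Term (Fin r), ∃ i, t = .var i := by
      rintro (i | ⟨f, _⟩)
      · exact ⟨i, rfl⟩
      · exact f.elim
    choose ι hι using fun k : K => hvar (I r ⟨⟨rfl⟩, k⟩)
    obtain ⟨k, k', π, π', h, hne⟩ := hτ ι
    have h' := hI _ (.inl ⟨k, k', π, π', h, rfl⟩) fun n => ⟨decide (n = π (ι k))⟩
    simp only [minorEquation, FirstOrder.Language.Term.substFunc, hι,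
      FirstOrder.Language.Term.subst, FirstOrder.Language.Term.realize_var, decide_true,
      ULift.up.injEq] at h'
    exact hne (of_decide_eq_true h'.symm).symm
  · refine ⟨fun n f => (τ f.down.2).relabel (Fin.cast f.down.1.down.symm), ?_⟩
    rintro _ (⟨k, k', π, π', h, rfl⟩ | ⟨n, f, rfl⟩) z
    · simpa [minorEquation, Function.comp_def] using h z
    · simp [idempotencyEquation, hA.realize_const]

theorem comp_vecCons {α β : Type*} (z : α → β) {n : ℕ} (i : α) (v : Fin n → α) :
    z ∘ Matrix.vecCons i v = Matrix.vecCons (z i) (z ∘ v) := by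
  ext j; refine Fin.cases rfl (fun _ => rfl) j

theorem comp_vecEmpty {α β : Type*} (z : α → β) : z ∘ ![] = ![] := Subsingleton.elim _ _

theorem isTaylor_of_isWeakThreeCubeTerm (hA : IdempotentAlgebra L A)
    (h : ∃ t : L.Term (Fin 6), IsWeakThreeCubeTerm A t) : IsTaylor.{u, v, a, w} L A := by
  obtain ⟨t, ht⟩ := h
  refine isTaylor_of_minors hA (fun _ : Unit => t) fun ι => ?_
  have hι : ∀ i : Fin 6, (![0, 1, 1, 1, 0, 0] i : ℕ) ≠ ![1, 0, 1, 0, 1, 0] i ∨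
      (![1, 0, 1, 0, 1, 0] i : ℕ) ≠ ![1, 1, 0, 0, 0, 1] i := by decide
  rcases hι (ι ()) with hne | hne
  · exact ⟨(), (), _, _, fun z => by simpa [comp_vecCons, comp_vecEmpty] using (ht (z 0) (z 1)).1, hne⟩
  · exact ⟨(), (), _, _, fun z => by simpa [comp_vecCons, comp_vecEmpty] using (ht (z 0) (z 1)).2, hne⟩

theorem isTaylor_of_isTerminator (hA : IdempotentAlgebra L A)
    (h : ∃ (c : L.Term (Fin 3)) (c₁ : Fin 2 → L.Term (Fin 3))
      (c₂ : Fin 2 → Fin 2 → L.Term (Fin 3)), IsTerminator A c c₁ c₂) :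
    IsTaylor.{u, v, a, w} L A := by
  obtain ⟨c, c₁, c₂, h⟩ := h
  refine isTaylor_of_minors hA
    (Sum.elim (fun _ : Unit => c) (Sum.elim c₁ fun p : Fin 2 × Fin 2 => c₂ p.1 p.2)) fun ι => ?_
  by_contra! hι
  -- The last two levels force each `c₁ i` to choose its third coordinate. Then `c` would have to
  -- choose both its second and its first.
  have hc₁ : ∀ i, ι (.inr (.inl i)) = 2 := by
    intro i
    have h1 := hι (.inr (.inl i)) (.inr (.inr (i, 0))) ![0, 1, 0] ![0, 0, 1]
      fun z => by simpa [comp_vecCons, comp_vecEmpty] using ((h (z 0) (z 1)).2.1 i).1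
    have h2 := hι (.inr (.inl i)) (.inr (.inr (i, 1))) ![1, 0, 0] ![0, 0, 1]
      fun z => by simpa [comp_vecCons, comp_vecEmpty] using ((h (z 0) (z 1)).2.1 i).2
    have h3 := hι (.inr (.inr (i, 0))) (.inr (.inr (i, 1))) ![0, 1, 0] ![0, 1, 0]
      fun z => by simpa [comp_vecCons, comp_vecEmpty] using ((h (z 0) (z 1)).2.2 i).1
    have h4 := hι (.inr (.inr (i, 0))) (.inr (.inr (i, 1))) ![1, 0, 0] ![1, 0, 0]
      fun z => by simpa [comp_vecCons, comp_vecEmpty] using ((h (z 0) (z 1)).2.2 i).2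
    generalize ι (.inr (.inl i)) = b at *
    generalize ι (.inr (.inr (i, 0))) = e at *
    generalize ι (.inr (.inr (i, 1))) = e' at *
    clear hι
    revert b e e'
    decide
  have h1 := hι (.inl ()) (.inr (.inl 0)) ![0, 1, 0] ![0, 0, 1]
    fun z => by simpa [comp_vecCons, comp_vecEmpty] using (h (z 0) (z 1)).1.1
  have h2 := hι (.inl ()) (.inr (.inl 1)) ![1, 0, 0] ![0, 0, 1]
    fun z => by simpa [comp_vecCons, comp_vecEmpty] using (h (z 0) (z 1)).1.2
  rw [hc₁] at h1 h2
  generalize ι (.inl ()) = b at *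
  clear hι
  revert b
  decide

theorem exists_isQQCTerms_of_isStrongDoubleLoopTerm
    (h : ∃ d : L.Term (Fin 12), IsStrongDoubleLoopTerm A d) :
    ∃ (q₁ q₂ : L.Term (Fin 4)) (c : L.Term (Fin 3)), IsQQCTerms A q₁ q₂ c := by
  obtain ⟨d, hd⟩ := h
  -- `q₁` has one variable for each pair of values in rows 2 and 3, `q₂` for each pair in rows 0 and
  -- 1. The variables of `c` mark the columns where rows 0 and 1 agree, where rows 2 and 3 agree,
  -- and where neither pair agrees.
  refine ⟨d.relabel ![0, 1, 2, 0, 1, 3, 2, 0, 1, 3, 0, 1],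
    d.relabel ![2, 2, 0, 0, 0, 0, 1, 1, 1, 1, 3, 3],
    d.relabel ![0, 0, 1, 2, 2, 1, 1, 2, 2, 1, 0, 0], fun x y => ?_⟩
  obtain ⟨h1, h2, h3⟩ := hd x y
  refine ⟨?_, ?_, ?_, ?_, ?_⟩
  · simpa [comp_vecCons, comp_vecEmpty] using h3
  · simpa [comp_vecCons, comp_vecEmpty] using ((h1.trans h2).trans h3).symm
  · simpa [comp_vecCons, comp_vecEmpty] using h1
  · simp [comp_vecCons, comp_vecEmpty]
  · simp [comp_vecCons, comp_vecEmpty]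

theorem exists_isStrongTerminator_of_isQQCTerms
    (h : ∃ (q₁ q₂ : L.Term (Fin 4)) (c : L.Term (Fin 3)), IsQQCTerms A q₁ q₂ c) :
    ∃ (c : L.Term (Fin 3)) (c₁ : Fin 2 → L.Term (Fin 3)) (c₂ : Fin 2 → Fin 2 → L.Term (Fin 3)),
      IsStrongTerminator A c c₁ c₂ := by
  obtain ⟨q₁, q₂, c, h⟩ := h
  refine ⟨c, ![q₁.relabel ![0, 1, 2, 2], q₂.relabel ![0, 1, 2, 2]],
    ![![q₁.relabel ![0, 2, 1, 0], q₁.relabel ![2, 0, 1, 0]],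
      ![q₂.relabel ![1, 2, 0, 1], q₂.relabel ![2, 1, 0, 1]]], fun x y => ?_, fun x y => ?_⟩
  · obtain ⟨h1, h2, h3, h4, h5⟩ := h x y
    refine ⟨⟨?_, ?_⟩, ?_, ?_⟩
    · simpa [comp_vecCons, comp_vecEmpty] using h4.symm
    · simpa [comp_vecCons, comp_vecEmpty] using h5.symm
    · intro i; fin_cases i <;> simp [comp_vecCons, comp_vecEmpty]
    · intro i; fin_cases i
      · simpa [comp_vecCons, comp_vecEmpty] using h1.symm
      · simpa [comp_vecCons, comp_vecEmpty] using h3.symm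
  · obtain ⟨h1, h2, h3, h4, h5⟩ := h x y
    simpa [comp_vecCons, comp_vecEmpty] using h2

end Minors

end EqCond

theorem mainTheorem2 (L : FirstOrder.Language.{u, v}) [L.IsAlgebraic]
    (A : Type a) [L.Structure A] (hA : EqCond.IdempotentAlgebra L A) :
    List.TFAE [
      EqCond.IsTaylor.{u, v, a, w} L A,
      ∃ d : L.Term (Fin 12), EqCond.IsDoubleLoopTerm A d,
      ∃ d : L.Term (Fin 12), EqCond.IsStrongDoubleLoopTerm A d,
      ∃ t : L.Term (Fin 6), EqCond.IsWeakThreeCubeTerm A t,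
      ∃ (q₁ q₂ : L.Term (Fin 4)) (c : L.Term (Fin 3)), EqCond.IsQQCTerms A q₁ q₂ c,
      ∃ (c : L.Term (Fin 3)) (c₁ : Fin 2 → L.Term (Fin 3)) (c₂ : Fin 2 → Fin 2 → L.Term (Fin 3)),
        EqCond.IsTerminator A c c₁ c₂,
      ∃ (c : L.Term (Fin 3)) (c₁ : Fin 2 → L.Term (Fin 3)) (c₂ : Fin 2 → Fin 2 → L.Term (Fin 3)),
        EqCond.IsStrongTerminator A c c₁ c₂] := by
  tfae_have 1 → 2 := EqCond.exists_isDoubleLoopTerm_of_isTaylor hA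
  tfae_have 2 → 3 := EqCond.exists_isStrongDoubleLoopTerm_of_isDoubleLoopTerm hA
  tfae_have 3 → 4 := EqCond.exists_isWeakThreeCubeTerm_of_isStrongDoubleLoopTerm hA
  tfae_have 4 → 1 := EqCond.isTaylor_of_isWeakThreeCubeTerm hA
  tfae_have 3 → 5 := EqCond.exists_isQQCTerms_of_isStrongDoubleLoopTerm
  tfae_have 5 → 7 := EqCond.exists_isStrongTerminator_of_isQQCTerms
  tfae_have 7 → 6 := fun ⟨c, c₁, c₂, h⟩ => ⟨c, c₁, c₂, h.1⟩
  tfae_have 6 → 1 := EqCond.isTaylor_of_isTerminator hA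
  tfae_finish
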